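/- Let $\mathcal X,\mathcal Y,\widehat{\mathcal Y}$ be measurable spaces such that singletons of $\mathcal X$ and $\mathcal Y$ are measurable and such that $\mathcal X$ or $\mathcal Y$ is infinite. Let $\ell:\widehat{\mathcal Y}\times\mathcal Y\to[0,B]$ be a measurable loss, and fix $\alpha\in(0,1)$, $\tau>0$ and integers $n,N\ge 1$. An *algorithm* $\mathcal A$ maps a data set $\mathcal D\in\bigcup_{m\ge 0}(\mathcal X\times\mathcal Y)^m$ and a seed $\xi\in[0,1]$ to a measurable function $\mathcal A(\mathcal D;\xi):\mathcal X\to\widehat{\mathcal Y}$, such that for each $m$ the map $(\mathcal D,\xi,x)\mapsto[\mathcal A(\mathcal D;\xi)](x)$ on $(\mathcal X\times\mathcal Y)^m\times[0,1]\times\mathcal X$ is measurable. For a probability measure $P$ on $\mathcal X\times\mathcal Y$ put $$R_P(f)=\mathbb E_P[\ell(f(X),Y)],\qquad R_P^{\max}=\sup_f R_P(f),$$ where the supremum is over all measurable $f:\mathcal X\to\widehat{\mathcal Y}$, and $$R_{P,n}(\mathcal A)=\mathbb E\big[\ell(\widehat f_n(X_{n+1}),Y_{n+1})\big],\qquad \widehat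 f_n=\mathcal A\big((X_i,Y_i)_{i\le n};\xi\big),$$ with $(X_i,Y_i)_{i\le n+1}$ i.i.d. from $P$ and $\xi\sim\mathrm{Unif}[0,1]$ independent of them. A *black-box test* $\widehat T$ takes an algorithm $\mathcal A$ and a data set $\mathcal D_N\in(\mathcal X\times\mathcal Y)^N$, uses i.i.d. seeds $\zeta^{(1)},\zeta^{(2)},\dots,\zeta\sim\mathrm{Unif}[0,1]$ independent of $\mathcal D_N$, and proceeds in rounds $r=1,2,\dots$. In round $r$ it chooses a data set $\mathcal D^{(r)}$ of any finite size and a seed $\xi^{(r)}\in[0,1]$ by an arbitrary fixed function of $\mathcal D_N$, the previous $(\mathcal D^{(s)},\xi^{(s)},\widehat f^{(s)},\zeta^{(s)})_{s<r}$, and $\zeta^{(r)}$, and obtains $\widehat f^{(r)}=\mathcal A(\mathcal D^{(r)};\xi^{(r)})$. After each round a fixed stopping criterion, depending on $\mathcal D_N$ and on all the rounds so far, decides whether to stop. When the procedure stops after $\widehat r$ rounds, it returns a value in $\{0,1\}$ that is a fixed function of $\mathcal D_N$, $(\mathcal D^{(r)},\xi^{(r)},\widehat f^{(r)},\zeta^{(r)})_{r\le\widehat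 r}$ and $\zeta$. It is required that, for every $\mathcal A$ and every $P$, $\widehat r<\infty$ almost surely when $\mathcal D_N$ is i.i.d. from $P$, and that, for every $\mathcal A$, the output is a measurable function of $(\mathcal D_N,\zeta^{(1)},\zeta^{(2)},\dots,\zeta)$. Write $\mathbb P_P(\widehat T(\mathcal A,\mathcal D_N)=1)$ for the probability of output $1$ when the points of $\mathcal D_N$ are i.i.d. from $P$. **Theorem.** Let $\widehat T$ be a black-box test such that $$\mathbb P_P(\widehat T(\mathcal A,\mathcal D_N)=1)\le\alpha\quad\text{for all }\mathcal A, P\text{ with }R_{P,n}(\mathcal A)\ge\tau,$$ and let $\tilde\tau=\tau\big(1+\frac{\alpha^{-1}-1}{N}\big)$. Then for every algorithm $\mathcal A$ and every probability measure $P$ with $R_{P,n}(\mathcal A)<\tau$ and $\tilde\tau<R_P^{\max}$, $$\mathbb P_P(\widehat T(\mathcal A,\mathcal D_N)=1)\le\left[\alpha\left(1+\frac{\tilde\tau-R_{P,n}(\mathcal A)}{R_P^{\max}-\tilde\tau}\right)^{N/n}\right]\wedge 1 .$$ In particular, for every real $K$ with $N\le Kn$, $$\mathbb P_P(\widehat T(\mathcal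 A,\mathcal D_N)=1)\le\left(\frac{R_P^{\max}}{R_P^{\max}-\tilde\tau}\right)^{K}\alpha .$$ -/

import Mathlib

open MeasureTheory

noncomputable section

namespace AlgEval

/-- A data set of arbitrary finite size, an element of `⋃_{m ≥ 0} (X × Y)^m`. -/
abbrev Dataset (X Y : Type*) := Σ m : ℕ, (Fin m → X × Y)

/-- A (possibly randomized) algorithm: it maps a data set of any size and a seed in `[0,1]` to a
fitted model `X → Yhat`. For each sample size the prediction is jointly measurable in the data, the
seed and the feature (in particular each fitted model is a measurable function). -/
structure Algorithm (X Y Yhat : Type*) [MeasurableSpace X] [MeasurableSpace Y]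
    [MeasurableSpace Yhat] where
  fit : Dataset X Y → unitInterval → X → Yhat
  measurable_fit : ∀ m : ℕ, Measurable
    (fun p : (Fin m → X × Y) × unitInterval × X => fit ⟨m, p.1⟩ p.2.1 p.2.2)

/-- The record of one round of a black-box procedure: the data set and the seed passed to the
algorithm, the model that it returned, and the random seed `ζ` available in that round. -/
structure Round (X Y Yhat : Type*) where
  data : Dataset X Y
  seed : unitInterval
  model : X → Yhat
  zeta : unitInterval

/-- The functions defining a black-box procedure for a data set of size `N`. Lists of rounds are in
chronological order, so the length of the list tells how many rounds have been carried out.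
* `query D h z` is the data set and seed to be used in the next round, given the original data, the
  past rounds `h` and the new random seed `z`;
* `halt D h` says whether the procedure stops after the rounds `h`;
* `answer D h z` is the final answer (`true` stands for `1`, `false` for `0`), given the rounds that
  were carried out and a last random seed `z`. -/
structure BlackBoxProcedure (X Y Yhat : Type*) (N : ℕ) where
  query : (Fin N → X × Y) → List (Round X Y Yhat) → unitInterval → Dataset X Y × unitInterval
  halt : (Fin N → X × Y) → List (Round X Y Yhat) → Prop
  answer : (Fin N → X × Y) → List (Round X Y Yhat) → unitInterval → Bool

/-- Everything that is random in a run: the original data set, the seeds of the successive rounds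
(`ω.2.1 r` is the seed of round `r + 1`), and the seed of the final decision. -/
abbrev RunSpace (X Y : Type*) (N : ℕ) :=
  (Fin N → X × Y) × (ℕ → unitInterval) × unitInterval

/-- The law of a run: the data points are i.i.d. from `P`, all seeds are i.i.d. uniform on `[0,1]`
and independent of the data. -/
def runLaw {X Y : Type*} [MeasurableSpace X] [MeasurableSpace Y] (P : Measure (X × Y)) (N : ℕ) :
    Measure (RunSpace X Y N) :=
  (Measure.pi (fun _ : Fin N => P)).prod
    ((Measure.infinitePi (fun _ : ℕ => (volume : Measure unitInterval))).prod
      (volume : Measure unitInterval))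

namespace BlackBoxProcedure

variable {X Y Yhat : Type*} [MeasurableSpace X] [MeasurableSpace Y] [MeasurableSpace Yhat] {N : ℕ}

/-- The first `r` rounds of the procedure applied to the algorithm `A` (disregarding the stopping
criterion). -/
def transcript (T : BlackBoxProcedure X Y Yhat N) (A : Algorithm X Y Yhat) (D : Fin N → X × Y)
    (ζ : ℕ → unitInterval) : ℕ → List (Round X Y Yhat)
  | 0 => []
  | r + 1 =>
    let h := transcript T A D ζ r
    let q := T.query D h (ζ r)
    h ++ [⟨q.1, q.2, A.fit q.1 q.2, ζ r⟩]

/-- The procedure stops after finitely many (and at least one) rounds. -/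
def Halts (T : BlackBoxProcedure X Y Yhat N) (A : Algorithm X Y Yhat) (D : Fin N → X × Y)
    (ζ : ℕ → unitInterval) : Prop :=
  ∃ r : ℕ, 1 ≤ r ∧ T.halt D (T.transcript A D ζ r)

/-- The total number of rounds (meaningful when the procedure halts). -/
def rounds (T : BlackBoxProcedure X Y Yhat N) (A : Algorithm X Y Yhat) (D : Fin N → X × Y)
    (ζ : ℕ → unitInterval) : ℕ :=
  sInf {r : ℕ | 1 ≤ r ∧ T.halt D (T.transcript A D ζ r)}

open Classical in
/-- The output of the procedure; a run that never stops (a null event for a black-box test)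
is counted as `0`. -/
def output (T : BlackBoxProcedure X Y Yhat N) (A : Algorithm X Y Yhat) (ω : RunSpace X Y N) :
    Bool :=
  if T.Halts A ω.1 ω.2.1 then
    T.answer ω.1 (T.transcript A ω.1 ω.2.1 (T.rounds A ω.1 ω.2.1)) ω.2.2
  else false

end BlackBoxProcedure

/-- A black-box test: a black-box procedure that, for every algorithm and every data distribution,
almost surely stops after finitely many rounds, and whose output is, for every algorithm, a
measurable function of the data and the random seeds. No measurability of the individual
functions `query`, `halt`, `answer` is required. -/
structure BlackBoxTest (X Y Yhat : Type*) [MeasurableSpace X] [MeasurableSpace Y]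
    [MeasurableSpace Yhat] (N : ℕ) extends BlackBoxProcedure X Y Yhat N where
  halts : ∀ (A : Algorithm X Y Yhat) (P : Measure (X × Y)) [IsProbabilityMeasure P],
    ∀ᵐ ω ∂(runLaw P N), toBlackBoxProcedure.Halts A ω.1 ω.2.1
  measurable_output : ∀ A : Algorithm X Y Yhat, Measurable (toBlackBoxProcedure.output A)

section Risk

variable {X Y Yhat : Type*} [MeasurableSpace X] [MeasurableSpace Y] [MeasurableSpace Yhat]

/-- The risk `R_P(f) = E_P[ℓ(f(X), Y)]` of a model. -/
def modelRisk (loss : Yhat → Y → ℝ) (P : Measure (X × Y)) (f : X → Yhat) : ℝ :=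
  ∫ z, loss (f z.1) z.2 ∂P

/-- `R_P^max`, the supremum of `R_P(f)` over all measurable functions `f`. -/
def maxRisk (loss : Yhat → Y → ℝ) (P : Measure (X × Y)) : ℝ :=
  ⨆ f : {f : X → Yhat // Measurable f}, modelRisk loss P f.1

/-- The risk `R_{P,n}(A) = E[ℓ(f̂_n(X_{n+1}), Y_{n+1})]` of an algorithm, where `f̂_n` is fitted on
`n` i.i.d. data points from `P` with an independent uniform seed, and the test point
`(X_{n+1}, Y_{n+1})` is an independent draw from `P`. -/
def algRisk (loss : Yhat → Y → ℝ) (P : Measure (X × Y)) (n : ℕ) (A : Algorithm X Y Yhat) : ℝ :=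
  ∫ p : (Fin n → X × Y) × unitInterval × (X × Y),
    loss (A.fit ⟨n, p.1⟩ p.2.1 p.2.2.1) p.2.2.2
    ∂((Measure.pi (fun _ : Fin n => P)).prod ((volume : Measure unitInterval).prod P))

/-- The probability that the test returns `1` on algorithm `A` when the data are i.i.d. from `P`. -/
def rejectProb {N : ℕ} (T : BlackBoxTest X Y Yhat N) (A : Algorithm X Y Yhat)
    (P : Measure (X × Y)) : ℝ :=
  (runLaw P N).real {ω | T.output A ω = true}

/-- Assumption-free validity at level `α` for the null hypothesis `R_{P,n}(A) ≥ τ`. -/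
def IsValid {N : ℕ} (loss : Yhat → Y → ℝ) (n : ℕ) (τ α : ℝ) (T : BlackBoxTest X Y Yhat N) : Prop :=
  ∀ (A : Algorithm X Y Yhat) (P : Measure (X × Y)) [IsProbabilityMeasure P],
    τ ≤ algRisk loss P n A → rejectProb T A P ≤ α

end Risk

/-- The adjusted threshold `τ̃ = τ (1 + (α⁻¹ - 1) / N)`. -/
def adjustedThreshold (τ α : ℝ) (N : ℕ) : ℝ := τ * (1 + (α⁻¹ - 1) / N)

end AlgEval

end

open MeasureTheory Set Filter Topology
open scoped NNReal ENNReal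

/-! A valid test cannot exclude that `A` fails badly after seeing one rare kind of data point. Fix a
model `g` of nearly maximal risk under `P` and disjoint measurable sets `S i` with points `z i ∈ S
i`. Let `A i` return `g` once its data meet `S i`, and agree with `A` otherwise; let `P i` be the
mixture `c P + (1 - c) δ_{z i}`.

Under `P i`, a training set of size `n` avoids `S i` with probability at most `c ^ n`, so `A i` has
risk at least about `c (M - c ^ n (M - R))`, where `M` is the maximal risk and `R` the risk of `A`
under `P`. If `c ^ n < (M - τ̃) / (M - R)` and `c ^ N ≥ α`, this is at least `c τ̃ ≥ τ` by
Bernoulli's inequality. Validity then bounds the rejection probability of `A i` under `P i` by `α`,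
hence under `P` by `α / c ^ N`, because `P i ≥ c P`.

A halting run queries finitely many points, so for large `i` it cannot tell `A i` from `A`
(`tendsto_rejectProb_sabotage`). The bound passes to `A` (`pow_mul_rejectProb_le`), and it remains
to optimise `c`. -/

namespace AlgEval

/-! ### Monotonicity and scaling of product measures -/

section ProductMeasures

theorem pi_mono_measure {ι : Type*} [Fintype ι] {α : ι → Type*} [∀ i, MeasurableSpace (α i)]
    {μ ν : ∀ i, Measure (α i)} (h : ∀ i, μ i ≤ ν i) : Measure.pi μ ≤ Measure.pi ν := by
  refine Measure.le_intro fun s hs _ => ?_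
  rw [Measure.pi, Measure.pi, toMeasure_apply _ _ hs, toMeasure_apply _ _ hs]
  -- The product outer measure is the largest one bounded on boxes by the product of the side
  -- measures, so comparing boxes suffices.
  refine OuterMeasure.le_pi.2 (fun t ht => ?_) s
  refine (OuterMeasure.pi_pi_le _ _).trans ?_
  exact Finset.prod_le_prod' fun i _ => h i (t i)

theorem pi_const_smul {α : Type*} [MeasurableSpace α] (μ : Measure α) [SigmaFinite μ] (c : ℝ≥0)
    (m : ℕ) : Measure.pi (fun _ : Fin m => c • μ) = c ^ m • Measure.pi (fun _ : Fin m => μ) := by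
  refine Measure.pi_eq fun s _ => ?_
  simp only [Measure.smul_apply, Measure.pi_pi, ENNReal.smul_def, smul_eq_mul,
    Finset.prod_mul_distrib, Finset.prod_const, Finset.card_univ, Fintype.card_fin,
    ENNReal.coe_pow]

end ProductMeasures

/-! ### Mixtures with a point mass -/

section Contamination

variable {Z : Type*} [MeasurableSpace Z]

/-- The mixture of `P` and a point mass at `z`, with weights `c` and `1 - c`. -/
noncomputable def contaminate (P : Measure Z) (z : Z) (c : ℝ≥0) : Measure Z :=
  c • P + (1 - c) • Measure.dirac z

theorem isProbabilityMeasure_contaminate (P : Measure Z) [IsProbabilityMeasure P] (z : Z)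
    {c : ℝ≥0} (hc : c ≤ 1) : IsProbabilityMeasure (contaminate P z c) := by
  constructor
  rw [contaminate, Measure.add_apply, Measure.smul_apply, Measure.smul_apply, measure_univ,
    measure_univ, ← add_smul, add_tsub_cancel_of_le hc, one_smul]

theorem smul_le_contaminate (P : Measure Z) (z : Z) (c : ℝ≥0) : c • P ≤ contaminate P z c :=
  Measure.le_add_right le_rfl

theorem contaminate_restrict_compl_le (P : Measure Z) {z : Z} {S : Set Z} (hS : MeasurableSet S)
    (hz : z ∈ S) (c : ℝ≥0) : (contaminate P z c).restrict Sᶜ ≤ c • P := by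
  have h : (Measure.dirac z).restrict Sᶜ = 0 := by
    rw [Measure.restrict_eq_zero, Measure.dirac_apply' _ hS.compl]
    simp [hz]
  rw [contaminate, Measure.restrict_add, Measure.restrict_smul, Measure.restrict_smul, h, smul_zero,
    add_zero, ← Measure.restrict_smul]
  exact Measure.restrict_le_self

theorem pow_smul_pi_le_pi_contaminate (P : Measure Z) [IsProbabilityMeasure P] (z : Z) (c : ℝ≥0)
    (m : ℕ) : c ^ m • Measure.pi (fun _ : Fin m => P) ≤
      Measure.pi (fun _ : Fin m => contaminate P z c) := by
  rw [← pi_const_smul]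
  exact pi_mono_measure fun _ => smul_le_contaminate P z c

/-- A sample avoiding `S` uses no draw from the point mass, so each coordinate contributes a factor
`c`. This holds even if `P` charges `S`. -/
theorem pi_contaminate_restrict_le (P : Measure Z) [IsProbabilityMeasure P] {z : Z} {S : Set Z}
    (hS : MeasurableSet S) (hz : z ∈ S) {c : ℝ≥0} (hc : c ≤ 1) (m : ℕ) :
    (Measure.pi (fun _ : Fin m => contaminate P z c)).restrict {D | ∀ j, D j ∉ S} ≤
      c ^ m • Measure.pi (fun _ : Fin m => P) := by
  have := isProbabilityMeasure_contaminate P z hc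
  have hset : {D : Fin m → Z | ∀ j, D j ∉ S} = Set.pi univ fun _ => Sᶜ := by ext; simp
  rw [hset, Measure.restrict_pi_pi, ← pi_const_smul]
  exact pi_mono_measure fun _ => contaminate_restrict_compl_le P hS hz c

end Contamination

theorem measurableSet_forall_notMem {Z : Type*} [MeasurableSpace Z] {S : Set Z}
    (hS : MeasurableSet S) (m : ℕ) : MeasurableSet {D : Fin m → Z | ∀ j, D j ∉ S} := by
  rw [Set.ofPred_forall]
  exact MeasurableSet.iInter fun j => measurable_pi_apply (X := fun _ => Z) j hS.compl

/-! ### Sabotaged algorithms and their indistinguishability from the original -/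

section Sabotage

variable {X Y Yhat : Type*} [MeasurableSpace X] [MeasurableSpace Y] [MeasurableSpace Yhat]

open Classical in
/-- The algorithm that returns the model `g` whenever a data point lies in `S`, and otherwise
behaves like `A`. -/
noncomputable def sabotage (A : Algorithm X Y Yhat) {S : Set (X × Y)} (hS : MeasurableSet S)
    {g : X → Yhat} (hg : Measurable g) : Algorithm X Y Yhat where
  fit D ξ := if ∀ j, D.2 j ∉ S then A.fit D ξ else g
  measurable_fit m := by
    have h := @Measurable.piecewise _ _ _ _ _ _ _ (Classical.decPred _)
      (measurable_fst (measurableSet_forall_notMem hS m))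
      (A.measurable_fit m) (hg.comp (measurable_snd.comp measurable_snd))
    convert h using 2 with p
    simp only [Set.piecewise, mem_preimage, mem_ofPred_eq]
    split_ifs <;> rfl

theorem sabotage_fit_of_forall_notMem (A : Algorithm X Y Yhat) {S : Set (X × Y)}
    (hS : MeasurableSet S) {g : X → Yhat} (hg : Measurable g) {D : Dataset X Y}
    (hD : ∀ j, D.2 j ∉ S) (ξ : unitInterval) : (sabotage A hS hg).fit D ξ = A.fit D ξ :=
  if_pos hD

theorem sabotage_fit_of_not (A : Algorithm X Y Yhat) {S : Set (X × Y)}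
    (hS : MeasurableSet S) {g : X → Yhat} (hg : Measurable g) {D : Dataset X Y}
    (hD : ¬ ∀ j, D.2 j ∉ S) (ξ : unitInterval) : (sabotage A hS hg).fit D ξ = g :=
  if_neg hD

theorem Algorithm.measurable_model (A : Algorithm X Y Yhat) (D : Dataset X Y) (ξ : unitInterval) :
    Measurable (A.fit D ξ) :=
  (A.measurable_fit D.1).comp (by fun_prop : Measurable fun x : X => (D.2, ξ, x))

theorem eventually_notMem_of_pairwise_disjoint {Z : Type*} {S : ℕ → Set Z}
    (hS : Pairwise (Function.onFun Disjoint S)) (z : Z) : ∀ᶠ i in atTop, z ∉ S i := by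
  by_cases h : ∃ i, z ∈ S i
  · obtain ⟨i, hi⟩ := h
    filter_upwards [eventually_gt_atTop i] with k hk hzk
    exact Set.disjoint_left.1 (hS hk.ne) hi hzk
  · push Not at h
    exact Eventually.of_forall h

variable {N : ℕ} (A : Algorithm X Y Yhat) {S : ℕ → Set (X × Y)}
  (hS : ∀ i, MeasurableSet (S i)) (hdisj : Pairwise (Function.onFun Disjoint S))
  {g : X → Yhat} (hg : Measurable g)

-- Each queried data set is finite and each of its points lies in at most one `S i`. While the past
-- rounds agree, the next query is the same, and for large `i` so is the returned model.
include hdisj in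
theorem eventually_transcript_sabotage_eq (T : BlackBoxProcedure X Y Yhat N) (D : Fin N → X × Y)
    (ζ : ℕ → unitInterval) (r : ℕ) :
    ∀ᶠ i in atTop, T.transcript (sabotage A (hS i) hg) D ζ r = T.transcript A D ζ r := by
  induction r with
  | zero => exact Eventually.of_forall fun _ => rfl
  | succ r ih =>
    have hq : ∀ᶠ i in atTop, ∀ j, (T.query D (T.transcript A D ζ r) (ζ r)).1.2 j ∉ S i :=
      eventually_all.2 fun j => eventually_notMem_of_pairwise_disjoint hdisj _
    filter_upwards [ih, hq] with i hi hqi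
    simp only [BlackBoxProcedure.transcript, hi]
    rw [sabotage_fit_of_forall_notMem A (hS i) hg hqi]

theorem output_eq_of_transcript_eq (T : BlackBoxProcedure X Y Yhat N) {A A' : Algorithm X Y Yhat}
    {ω : RunSpace X Y N} (h : T.Halts A ω.1 ω.2.1)
    (heq : ∀ r ≤ T.rounds A ω.1 ω.2.1,
      T.transcript A' ω.1 ω.2.1 r = T.transcript A ω.1 ω.2.1 r) :
    T.output A' ω = T.output A ω := by
  have hmem : T.rounds A ω.1 ω.2.1 ∈
      {r : ℕ | 1 ≤ r ∧ T.halt ω.1 (T.transcript A ω.1 ω.2.1 r)} := Nat.sInf_mem h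
  have hmem' : T.rounds A ω.1 ω.2.1 ∈
      {r : ℕ | 1 ≤ r ∧ T.halt ω.1 (T.transcript A' ω.1 ω.2.1 r)} := by
    refine ⟨hmem.1, ?_⟩
    rw [heq _ le_rfl]
    exact hmem.2
  have h' : T.Halts A' ω.1 ω.2.1 := ⟨_, hmem'⟩
  have hle : T.rounds A' ω.1 ω.2.1 ≤ T.rounds A ω.1 ω.2.1 := Nat.sInf_le hmem'
  have hrounds : T.rounds A' ω.1 ω.2.1 = T.rounds A ω.1 ω.2.1 := by
    refine le_antisymm hle (Nat.sInf_le ?_)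
    have hm : T.rounds A' ω.1 ω.2.1 ∈
      {r : ℕ | 1 ≤ r ∧ T.halt ω.1 (T.transcript A' ω.1 ω.2.1 r)} := Nat.sInf_mem h'
    refine ⟨hm.1, ?_⟩
    rw [← heq _ hle]
    exact hm.2
  simp only [BlackBoxProcedure.output, h, h', if_true]
  rw [hrounds, heq _ le_rfl]

instance isProbabilityMeasure_runLaw (P : Measure (X × Y)) [IsProbabilityMeasure P] :
    IsProbabilityMeasure (runLaw P N) := by
  unfold runLaw; infer_instance

theorem measurableSet_output_eq_true (T : BlackBoxTest X Y Yhat N) (A : Algorithm X Y Yhat) :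
    MeasurableSet {ω | T.output A ω = true} :=
  T.measurable_output A (measurableSet_singleton true)

-- Almost every run halts, so its output depends on finitely many rounds and is eventually
-- unchanged; pointwise convergence of indicators gives convergence of probabilities. No uniform
-- bound on the number of rounds is needed.
include hdisj in
theorem tendsto_rejectProb_sabotage (T : BlackBoxTest X Y Yhat N) (P : Measure (X × Y))
    [IsProbabilityMeasure P] :
    Tendsto (fun i => rejectProb T (sabotage A (hS i) hg) P) atTop (𝓝 (rejectProb T A P)) := by
  refine (ENNReal.tendsto_toReal (measure_ne_top _ _)).comp
    (tendsto_measure_of_ae_tendsto_indicator_of_isFiniteMeasure atTop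
      (measurableSet_output_eq_true T A)
      (fun i => measurableSet_output_eq_true T (sabotage A (hS i) hg)) ?_)
  filter_upwards [T.halts A P] with ω hω
  have h : ∀ᶠ i in atTop, ∀ r ∈ Finset.range (T.rounds A ω.1 ω.2.1 + 1),
      T.transcript (sabotage A (hS i) hg) ω.1 ω.2.1 r = T.transcript A ω.1 ω.2.1 r :=
    (Finset.eventually_all _).2 fun r _ =>
      eventually_transcript_sabotage_eq A hS hdisj hg T.toBlackBoxProcedure ω.1 ω.2.1 r
  filter_upwards [h] with i hi
  have := output_eq_of_transcript_eq T.toBlackBoxProcedure hω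
    fun r hr => hi r (Finset.mem_range.2 (by omega))
  simp only [this]

theorem pow_mul_rejectProb_le_contaminate (T : BlackBoxTest X Y Yhat N) (A : Algorithm X Y Yhat)
    (P : Measure (X × Y)) [IsProbabilityMeasure P] (z : X × Y) {c : ℝ≥0} (hc : c ≤ 1) :
    (c : ℝ) ^ N * rejectProb T A P ≤ rejectProb T A (contaminate P z c) := by
  have := isProbabilityMeasure_contaminate P z hc
  have hle : c ^ N • runLaw P N ≤ runLaw (contaminate P z c) N := by
    unfold runLaw
    rw [← Measure.prod_smul_left]
    exact Measure.prod_mono (pow_smul_pi_le_pi_contaminate P z c N) le_rfl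
  have h := ENNReal.toReal_mono (measure_ne_top _ _) (hle {ω | T.output A ω = true})
  simpa [rejectProb, Measure.real, ENNReal.smul_def] using h

end Sabotage

/-! ### Risk of the sabotaged algorithm under contamination -/

section RiskBounds

variable {X Y Yhat : Type*} [MeasurableSpace X] [MeasurableSpace Y] [MeasurableSpace Yhat]
  {loss : Yhat → Y → ℝ} {B : ℝ}

section

variable (hloss : Measurable (fun p : Yhat × Y => loss p.1 p.2))
  (hB : ∀ (yhat : Yhat) (y : Y), 0 ≤ loss yhat y ∧ loss yhat y ≤ B)
include hloss hB

theorem integrable_loss {Ω : Type*} [MeasurableSpace Ω] (μ : Measure Ω) [IsFiniteMeasure μ]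
    {f : Ω → Yhat} {y : Ω → Y} (hf : Measurable f) (hy : Measurable y) :
    Integrable (fun ω => loss (f ω) (y ω)) μ :=
  Integrable.of_bound (hloss.comp (hf.prodMk hy)).aestronglyMeasurable B
    (ae_of_all _ fun ω => by
      rw [Real.norm_of_nonneg (hB _ _).1]
      exact (hB _ _).2)

theorem modelRisk_le (P : Measure (X × Y)) [IsProbabilityMeasure P] {f : X → Yhat}
    (hf : Measurable f) : modelRisk loss P f ≤ B := by
  have h := integral_mono (integrable_loss hloss hB P (hf.comp measurable_fst) measurable_snd)
    (integrable_const B) fun z => (hB (f z.1) z.2).2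
  simpa [modelRisk] using h

theorem modelRisk_le_maxRisk (P : Measure (X × Y)) [IsProbabilityMeasure P] {f : X → Yhat}
    (hf : Measurable f) : modelRisk loss P f ≤ maxRisk loss P :=
  le_ciSup (f := fun f : {f : X → Yhat // Measurable f} => modelRisk loss P f.1)
    ⟨B, by rintro _ ⟨f, rfl⟩; exact modelRisk_le hloss hB P f.2⟩ ⟨f, hf⟩

theorem mul_modelRisk_le_contaminate (P : Measure (X × Y)) [IsProbabilityMeasure P] (z : X × Y)
    {c : ℝ≥0} (hc : c ≤ 1) {f : X → Yhat} (hf : Measurable f) :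
    c * modelRisk loss P f ≤ modelRisk loss (contaminate P z c) f := by
  have := isProbabilityMeasure_contaminate P z hc
  have h := integral_mono_measure (smul_le_contaminate P z c)
    (ae_of_all _ fun z : X × Y => (hB (f z.1) z.2).1)
    (integrable_loss hloss hB _ (hf.comp measurable_fst) measurable_snd)
  rwa [integral_smul_nnreal_measure] at h

theorem integrable_modelRisk_fit (P : Measure (X × Y)) [IsProbabilityMeasure P]
    (A : Algorithm X Y Yhat) (n : ℕ) (μ : Measure ((Fin n → X × Y) × unitInterval))
    [IsFiniteMeasure μ] :
    Integrable (fun p : (Fin n → X × Y) × unitInterval =>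
      modelRisk loss P (A.fit ⟨n, p.1⟩ p.2)) μ := by
  have h : Measurable (fun q : ((Fin n → X × Y) × unitInterval) × (X × Y) =>
      A.fit ⟨n, q.1.1⟩ q.1.2 q.2.1) :=
    (A.measurable_fit n).comp (by fun_prop : Measurable
      fun q : ((Fin n → X × Y) × unitInterval) × (X × Y) => (q.1.1, q.1.2, q.2.1))
  exact (integrable_loss hloss hB (μ.prod P) h
    (measurable_snd.comp measurable_snd)).integral_prod_left

theorem algRisk_eq_integral_modelRisk (P : Measure (X × Y)) [IsProbabilityMeasure P]
    (n : ℕ) (A : Algorithm X Y Yhat) :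
    algRisk loss P n A = ∫ p : (Fin n → X × Y) × unitInterval,
      modelRisk loss P (A.fit ⟨n, p.1⟩ p.2)
        ∂((Measure.pi (fun _ : Fin n => P)).prod volume) := by
  have h : Measurable (fun q : ((Fin n → X × Y) × unitInterval) × (X × Y) =>
      A.fit ⟨n, q.1.1⟩ q.1.2 q.2.1) :=
    (A.measurable_fit n).comp (by fun_prop : Measurable
      fun q : ((Fin n → X × Y) × unitInterval) × (X × Y) => (q.1.1, q.1.2, q.2.1))
  have hint := integrable_loss hloss hB
    (((Measure.pi (fun _ : Fin n => P)).prod (volume : Measure unitInterval)).prod P) h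
    (measurable_snd.comp measurable_snd)
  unfold modelRisk
  refine Eq.trans ?_ (integral_prod _ hint)
  exact ((measurePreserving_prodAssoc (Measure.pi (fun _ : Fin n => P))
    (volume : Measure unitInterval) P).integral_comp' (g := fun p =>
      loss (A.fit ⟨n, p.1⟩ p.2.1 p.2.2.1) p.2.2.2)).symm

/-- On a contaminated distribution, the sabotaged algorithm has a risk close to that of the
bad model `g`. -/
theorem le_algRisk_sabotage_contaminate (P : Measure (X × Y)) [IsProbabilityMeasure P]
    (A : Algorithm X Y Yhat) {S : Set (X × Y)} (hS : MeasurableSet S) {g : X → Yhat}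
    (hg : Measurable g) {z : X × Y} (hz : z ∈ S) {c : ℝ≥0} (hc : c ≤ 1) (n : ℕ) :
    c * (modelRisk loss P g - c ^ n * (maxRisk loss P - algRisk loss P n A)) ≤
      algRisk loss (contaminate P z c) n (sabotage A hS hg) := by
  have := isProbabilityMeasure_contaminate P z hc
  set G : Set ((Fin n → X × Y) × unitInterval) := {D | ∀ j, D j ∉ S} ×ˢ univ with hG
  have hGm : MeasurableSet G := (measurableSet_forall_notMem hS n).prod .univ
  set μ := (Measure.pi (fun _ : Fin n => P)).prod (volume : Measure unitInterval) with hμ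
  set ν := (Measure.pi (fun _ : Fin n => contaminate P z c)).prod
    (volume : Measure unitInterval) with hν
  have hνμ : ν.restrict G ≤ c ^ n • μ := by
    rw [hν, hG, ← Measure.prod_restrict, Measure.restrict_univ, hμ, ← Measure.prod_smul_left]
    exact Measure.prod_mono (pi_contaminate_restrict_le P hS hz hc n) le_rfl
  -- The shortfall from the maximal risk is nonnegative, so its integral over `G` can be bounded
  -- through `ν.restrict G ≤ c ^ n • μ`.
  set F : (Fin n → X × Y) × unitInterval → ℝ := fun p =>
    maxRisk loss P - modelRisk loss P (A.fit ⟨n, p.1⟩ p.2) with hF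
  have hF0 : ∀ p, 0 ≤ F p := fun p =>
    sub_nonneg.2 (modelRisk_le_maxRisk hloss hB P (A.measurable_model _ _))
  have hFμ : Integrable F μ :=
    (integrable_const _).sub (integrable_modelRisk_fit hloss hB P A n μ)
  have hFν : Integrable F ν :=
    (integrable_const _).sub (integrable_modelRisk_fit hloss hB P A n ν)
  have hbound : ∫ p in G, F p ∂ν ≤ c ^ n * (maxRisk loss P - algRisk loss P n A) := by
    have h := integral_mono_measure hνμ (ae_of_all _ hF0) hFμ.smul_measure_nnreal
    rw [integral_smul_nnreal_measure] at h
    refine h.trans_eq ?_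
    rw [hF, integral_sub (integrable_const _) (integrable_modelRisk_fit hloss hB P A n μ),
      algRisk_eq_integral_modelRisk hloss hB]
    simp [NNReal.smul_def, hμ]
  have hpoint : ∀ p : (Fin n → X × Y) × unitInterval,
      c * (modelRisk loss P g - G.indicator F p) ≤
        modelRisk loss (contaminate P z c) ((sabotage A hS hg).fit ⟨n, p.1⟩ p.2) := by
    intro p
    refine le_trans (mul_le_mul_of_nonneg_left ?_ c.2) (mul_modelRisk_le_contaminate hloss hB P z hc
      ((sabotage A hS hg).measurable_model ⟨n, p.1⟩ p.2))
    by_cases hp : ∀ j, p.1 j ∉ S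
    · have hpG : p ∈ G := ⟨hp, mem_univ _⟩
      rw [sabotage_fit_of_forall_notMem A hS hg hp, indicator_of_mem hpG]
      have := modelRisk_le_maxRisk hloss hB P hg
      simp only [hF]
      linarith
    · have hpG : p ∉ G := fun h => hp h.1
      rw [sabotage_fit_of_not A hS hg hp, indicator_of_notMem hpG, sub_zero]
  rw [algRisk_eq_integral_modelRisk hloss hB (contaminate P z c)]
  have hint : Integrable (fun p => modelRisk loss P g - G.indicator F p) ν :=
    (integrable_const _).sub (hFν.indicator hGm)
  refine le_trans ?_ (integral_mono (hint.const_mul (c : ℝ))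
    (integrable_modelRisk_fit hloss hB _ (sabotage A hS hg) n _) hpoint)
  rw [integral_const_mul, integral_sub (integrable_const _) (hFν.indicator hGm),
    integral_indicator hGm]
  refine mul_le_mul_of_nonneg_left ?_ c.2
  simp only [integral_const, probReal_univ, one_smul]
  linarith

end

end RiskBounds

/-! ### Choice of the trigger sets, the threshold, and the contamination level -/

theorem exists_disjoint_strips {X Y : Type*} [MeasurableSpace X] [MeasurableSingletonClass X]
    [MeasurableSpace Y] [MeasurableSingletonClass Y] [Nonempty X] [Nonempty Y]
    (hinf : Infinite X ∨ Infinite Y) :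
    ∃ (S : ℕ → Set (X × Y)) (z : ℕ → X × Y), (∀ i, MeasurableSet (S i)) ∧
      Pairwise (Function.onFun Disjoint S) ∧ ∀ i, z i ∈ S i := by
  obtain h | h := hinf
  · let e := Infinite.natEmbedding X
    obtain ⟨y⟩ := ‹Nonempty Y›
    refine ⟨fun i => Prod.fst ⁻¹' {e i}, fun i => (e i, y),
      fun i => measurable_fst (measurableSet_singleton _), fun i j hij => ?_, fun i => rfl⟩
    exact Disjoint.preimage _ (by simpa using hij)
  · let e := Infinite.natEmbedding Y
    obtain ⟨x⟩ := ‹Nonempty X›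
    refine ⟨fun i => Prod.snd ⁻¹' {e i}, fun i => (x, e i),
      fun i => measurable_snd (measurableSet_singleton _), fun i j hij => ?_, fun i => rfl⟩
    exact Disjoint.preimage _ (by simpa using hij)

/-- Bernoulli's inequality for `c⁻¹` gives `1 + N (c⁻¹ - 1) ≤ c⁻¹ ^ N ≤ α⁻¹`. Thus `τ̃` absorbs the
factor `c` lost when the point mass is dropped from the test risk. -/
theorem le_mul_adjustedThreshold {τ α c : ℝ} {N : ℕ} (hτ : 0 ≤ τ) (hα : 0 < α) (hN : 1 ≤ N)
    (hc : 0 < c) (hcN : α ≤ c ^ N) : τ ≤ c * adjustedThreshold τ α N := by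
  have hN' : (0 : ℝ) < N := by exact_mod_cast hN
  have h1 : 1 + (N : ℝ) * (c⁻¹ - 1) ≤ α⁻¹ := by
    have hb := one_add_mul_le_pow (a := c⁻¹ - 1) (by have := inv_pos.2 hc; linarith) N
    have hi : (c ^ N)⁻¹ ≤ α⁻¹ := inv_anti₀ hα hcN
    rw [add_sub_cancel, inv_pow] at hb
    exact hb.trans hi
  have h2 : c⁻¹ ≤ 1 + (α⁻¹ - 1) / N := by
    have : c⁻¹ - 1 ≤ (α⁻¹ - 1) / N := by
      rw [le_div_iff₀ hN']
      linarith
    linarith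
  have h3 : 1 ≤ c * (1 + (α⁻¹ - 1) / N) := by
    have := mul_le_mul_of_nonneg_left h2 hc.le
    rwa [mul_inv_cancel₀ hc.ne'] at this
  calc τ = τ * 1 := (mul_one τ).symm
    _ ≤ τ * (c * (1 + (α⁻¹ - 1) / N)) := mul_le_mul_of_nonneg_left h3 hτ
    _ = c * adjustedThreshold τ α N := by unfold adjustedThreshold; ring

theorem le_adjustedThreshold {τ α : ℝ} {N : ℕ} (hτ : 0 ≤ τ) (hα : 0 < α) (hα1 : α ≤ 1)
    (hN : 1 ≤ N) : τ ≤ adjustedThreshold τ α N := by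
  simpa using le_mul_adjustedThreshold hτ hα hN one_pos (by simpa using hα1)

/-- Validity of the test for the sabotaged algorithms bounds its power, for any contamination level
at which they satisfy the null hypothesis. -/
theorem pow_mul_rejectProb_le {X Y Yhat : Type*}
    [MeasurableSpace X] [MeasurableSingletonClass X]
    [MeasurableSpace Y] [MeasurableSingletonClass Y] [MeasurableSpace Yhat]
    (hinf : Infinite X ∨ Infinite Y)
    {loss : Yhat → Y → ℝ} (hloss : Measurable (fun p : Yhat × Y => loss p.1 p.2))
    {B : ℝ} (hB : ∀ (yhat : Yhat) (y : Y), 0 ≤ loss yhat y ∧ loss yhat y ≤ B)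
    {n N : ℕ} (hN : 1 ≤ N) {α τ : ℝ} (hα0 : 0 < α) (hτ : 0 < τ)
    (T : BlackBoxTest X Y Yhat N) (hT : IsValid loss n τ α T) (A : Algorithm X Y Yhat)
    (P : Measure (X × Y)) [IsProbabilityMeasure P] {c : ℝ≥0} (hc0 : 0 < c) (hc1 : c ≤ 1)
    (hcN : α ≤ (c : ℝ) ^ N)
    (hcn : (c : ℝ) ^ n * (maxRisk loss P - algRisk loss P n A) <
      maxRisk loss P - adjustedThreshold τ α N) :
    (c : ℝ) ^ N * rejectProb T A P ≤ α := by
  obtain ⟨z₀⟩ : Nonempty (X × Y) := P.nonempty_of_neZero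
  have : Nonempty X := ⟨z₀.1⟩
  have : Nonempty Y := ⟨z₀.2⟩
  have : Nonempty {f : X → Yhat // Measurable f} :=
    ⟨⟨A.fit ⟨0, Fin.elim0⟩ 0, A.measurable_model _ _⟩⟩
  -- The supremum need not be attained; the strict inequality `hcn` leaves room for a
  -- near-maximiser.
  obtain ⟨⟨g, hg⟩, hgr⟩ := exists_lt_of_lt_ciSup
    (show adjustedThreshold τ α N + (c : ℝ) ^ n * (maxRisk loss P - algRisk loss P n A) <
      ⨆ f : {f : X → Yhat // Measurable f}, modelRisk loss P f.1 by
        change _ < maxRisk loss P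
        linarith)
  obtain ⟨S, z, hS, hdisj, hz⟩ := exists_disjoint_strips hinf
  refine le_of_tendsto ((tendsto_rejectProb_sabotage A hS hdisj hg T P).const_mul _)
    (Eventually.of_forall fun i => ?_)
  refine (pow_mul_rejectProb_le_contaminate T _ P (z i) hc1).trans ?_
  have := isProbabilityMeasure_contaminate P (z i) hc1
  refine hT _ _ ?_
  refine le_trans ?_ (le_algRisk_sabotage_contaminate hloss hB P A (hS i) hg (hz i) hc1 n)
  refine (le_mul_adjustedThreshold hτ.le hα0 hN (NNReal.coe_pos.2 hc0) hcN).trans ?_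
  exact mul_le_mul_of_nonneg_left (by simp only at hgr; linarith) c.2

theorem rejectProb_le_one {X Y Yhat : Type*} [MeasurableSpace X] [MeasurableSpace Y]
    [MeasurableSpace Yhat] {N : ℕ} (T : BlackBoxTest X Y Yhat N) (A : Algorithm X Y Yhat)
    (P : Measure (X × Y)) [IsProbabilityMeasure P] : rejectProb T A P ≤ 1 :=
  measureReal_le_one

end AlgEval

open AlgEval

theorem mainTheorem2 {X Y Yhat : Type*}
    [MeasurableSpace X] [MeasurableSingletonClass X]
    [MeasurableSpace Y] [MeasurableSingletonClass Y]
    [MeasurableSpace Yhat]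
    (hinf : Infinite X ∨ Infinite Y)
    (loss : Yhat → Y → ℝ) (hloss : Measurable (fun p : Yhat × Y => loss p.1 p.2))
    (B : ℝ) (hB : ∀ (yhat : Yhat) (y : Y), 0 ≤ loss yhat y ∧ loss yhat y ≤ B)
    (n N : ℕ) (hn : 1 ≤ n) (hN : 1 ≤ N)
    (α τ : ℝ) (hα0 : 0 < α) (hα1 : α < 1) (hτ : 0 < τ)
    (T : AlgEval.BlackBoxTest X Y Yhat N)
    (hT : AlgEval.IsValid loss n τ α T)
    (A : AlgEval.Algorithm X Y Yhat)
    (P : MeasureTheory.Measure (X × Y)) [MeasureTheory.IsProbabilityMeasure P]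
    (hrisk : AlgEval.algRisk loss P n A < τ)
    (hmax : AlgEval.adjustedThreshold τ α N < AlgEval.maxRisk loss P) :
    AlgEval.rejectProb T A P ≤
      min (α * (1 + (AlgEval.adjustedThreshold τ α N - AlgEval.algRisk loss P n A) /
              (AlgEval.maxRisk loss P - AlgEval.adjustedThreshold τ α N)) ^ ((N : ℝ) / (n : ℝ))) 1
    ∧ ∀ K : ℝ, (N : ℝ) ≤ K * n →
      AlgEval.rejectProb T A P ≤
        (AlgEval.maxRisk loss P /
            (AlgEval.maxRisk loss P - AlgEval.adjustedThreshold τ α N)) ^ K * α := by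
  set M := maxRisk loss P with hM
  set t := adjustedThreshold τ α N with ht
  set R := algRisk loss P n A with hR
  have hτt : τ ≤ t := le_adjustedThreshold hτ.le hα0 hα1.le hN
  have hR0 : 0 ≤ R := MeasureTheory.integral_nonneg fun p => (hB _ _).1
  have hMt : 0 < M - t := sub_pos.2 hmax
  have hRt : R < t := hrisk.trans_le hτt
  have hn0 : (0 : ℝ) < n := by exact_mod_cast hn
  have hN0 : (0 : ℝ) < N := by exact_mod_cast hN
  have hbase : 1 + (t - R) / (M - t) = (M - R) / (M - t) := by
    field_simp
    ring
  set b := (M - R) / (M - t) with hb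
  have hb1 : 1 < b := (one_lt_div hMt).2 (by linarith)
  have hb0 : 0 < b := one_pos.trans hb1
  set q := rejectProb T A P with hq
  have hq0 : 0 ≤ q := MeasureTheory.measureReal_nonneg
  have hq1 : q ≤ 1 := rejectProb_le_one T A P
  have main : q ≤ α * b ^ ((N : ℝ) / n) := by
    have hpos : 0 < b ^ ((N : ℝ) / n) := Real.rpow_pos_of_pos hb0 _
    -- The critical level, where `c₀ ^ n * (M - R) = M - t`.
    set c₀ : ℝ := b ^ (-(1 / (n : ℝ))) with hc₀
    have hc₀0 : 0 < c₀ := Real.rpow_pos_of_pos hb0 _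
    have hc₀1 : c₀ < 1 := Real.rpow_lt_one_of_one_lt_of_neg hb1 (by
      have := one_div_pos.2 hn0
      linarith)
    have hc₀n : c₀ ^ n = b⁻¹ := by
      rw [hc₀, ← Real.rpow_natCast, ← Real.rpow_mul hb0.le, ← Real.rpow_neg_one]
      congr 1
      field_simp
    have hc₀N : c₀ ^ N = (b ^ ((N : ℝ) / n))⁻¹ := by
      rw [hc₀, ← Real.rpow_natCast, ← Real.rpow_mul hb0.le, ← Real.rpow_neg hb0.le]
      congr 1
      field_simp
    rcases le_or_gt (c₀ ^ N) α with hle | hlt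
    -- Here the claimed bound is at least `1`.
    · refine hq1.trans ?_
      rw [hc₀N, inv_le_iff_one_le_mul₀ hpos] at hle
      exact hle
    -- The argument needs `c < c₀` strictly, so the bound at `c₀` is a limit from the left; `α < c ^
    -- N` persists near `c₀`.
    · have hlim : Filter.Tendsto (fun c : ℝ => c ^ N * q) (nhdsWithin c₀ (Set.Iio c₀))
          (nhds (c₀ ^ N * q)) :=
        ((continuous_id.pow N).mul continuous_const).continuousWithinAt
      have hev : ∀ᶠ c : ℝ in nhdsWithin c₀ (Set.Iio c₀), c ^ N * q ≤ α := by
        have h1 : ∀ᶠ c : ℝ in nhdsWithin c₀ (Set.Iio c₀), 0 < c :=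
          nhdsWithin_le_nhds (lt_mem_nhds hc₀0)
        have h2 : ∀ᶠ c : ℝ in nhdsWithin c₀ (Set.Iio c₀), α < c ^ N :=
          nhdsWithin_le_nhds ((continuous_id.pow N).continuousAt.eventually (lt_mem_nhds hlt))
        filter_upwards [h1, h2, self_mem_nhdsWithin] with c hc hcN hcc
        have hcc' : c < c₀ := hcc
        refine pow_mul_rejectProb_le hinf hloss hB hN hα0 hτ T hT A P (c := ⟨c, hc.le⟩)
          hc (hcc'.le.trans hc₀1.le) hcN.le ?_
        have hpow : c ^ n < b⁻¹ := hc₀n ▸ pow_lt_pow_left₀ hcc' hc.le (by omega)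
        calc c ^ n * (M - R) < b⁻¹ * (M - R) := mul_lt_mul_of_pos_right hpow (by linarith)
          _ = M - t := by
            rw [hb, inv_div]
            exact div_mul_cancel₀ _ (by linarith)
      have h := le_of_tendsto hlim hev
      rw [hc₀N, inv_mul_le_iff₀ hpos] at h
      linarith
  refine ⟨?_, fun K hK => ?_⟩
  · rw [hbase]
    exact le_min main hq1
  · have hb' : b ≤ M / (M - t) := div_le_div_of_nonneg_right (by linarith) hMt.le
    have hNK : (N : ℝ) / n ≤ K := (div_le_iff₀ hn0).2 hK
    calc q ≤ α * b ^ ((N : ℝ) / n) := main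
      _ ≤ α * (M / (M - t)) ^ K := by
        refine mul_le_mul_of_nonneg_left ?_ hα0.le
        exact (Real.rpow_le_rpow hb0.le hb' (by positivity)).trans
          (Real.rpow_le_rpow_of_exponent_le (hb1.le.trans hb') hNK)
      _ = _ := mul_comm _ _
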